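/- Let $d\ge N\ge 2$ be integers and endow $\mathbb R^N$ with its Euclidean structure. Let $\mathcal P^{m}(\mathbb R^N)$ be the space of real polynomials in $N$ variables of total degree at most $m$. A family of $d$ distinct hyperplanes $\ell_1,\dots,\ell_d$ of $\mathbb R^N$ is in general position if for every $N$-element subset $H\subset\{1,\dots,d\}$ the intersection $\bigcap_{i\in H}\ell_i$ is a single point $\vartheta_H$, and the map $H\mapsto\vartheta_H$ is one-to-one; the set $\Theta$ of all the points $\vartheta_H$ is then called the Chung–Yao lattice (of degree $d-N$) of the family. For every $s\in\mathbb N$ let $\ell^{(s)}_i=\{x\in\mathbb R^N:\langle \mathbf n^{(s)}_i,x\rangle-c^{(s)}_i=0\}$, $i=1,\dots,d$, with $\|\mathbf n^{(s)}_i\|=1$ and $c^{(s)}_i\in\mathbb R$, be a family of $d$ hyperplanes in general position, and let $\Theta^{(s)}$ be its Chung–Yao lattice. Assume: (C1) $\max\{\|\vartheta\|:\vartheta\in\Theta^{(s)}\}\to 0$ as $s\to\infty$; (C2) there is $\delta>0$ such that, for all $s\in\mathbb N$ and all $1\le i_1<\dots<i_N\le d$, the $N$-dimensional volume of the parallelotope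 spanned by $\mathbf n^{(s)}_{i_1},\dots,\mathbf n^{(s)}_{i_N}$ is at least $\delta$. Then every $\Theta^{(s)}$ is an interpolation lattice of degree $d-N$, that is, for every real function $f$ on $\Theta^{(s)}$ there is a unique polynomial $\mathbf L[\Theta^{(s)};f]\in\mathcal P^{d-N}(\mathbb R^N)$ that coincides with $f$ on $\Theta^{(s)}$. Moreover, for every function $f:\mathbb R^N\to\mathbb R$ that is of class $C^{d-N+1}$ on a neighborhood of the origin, $$\lim_{s\to\infty}\mathbf L[\Theta^{(s)};f]=\mathbf T_0^{d-N}(f),$$ where $\mathbf T_0^{d-N}(f)(x)=\sum_{k=0}^{d-N}\frac1{k!}D^kf(0)(x,\dots,x)$ is the Taylor polynomial of $f$ at $0$ to the order $d-N$, and the limit is taken in $\mathcal P^{d-N}(\mathbb R^N)$ with respect to any norm (equivalently, coefficientwise). -/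

import Mathlib

open MeasureTheory Filter Topology

noncomputable section

namespace ChungYao

/-- `ℝ^N` with its canonical Euclidean structure. -/
abbrev E (N : ℕ) : Type := EuclideanSpace ℝ (Fin N)

/-- The space of real polynomials in `N` variables of total degree at most `m`. -/
abbrev PolyLE (N m : ℕ) : Submodule ℝ (MvPolynomial (Fin N) ℝ) :=
  MvPolynomial.restrictTotalDegree (Fin N) ℝ m

/-- The value of a polynomial at a point of `ℝ^N`. -/
def evalAt {N m : ℕ} (P : PolyLE N m) (x : E N) : ℝ :=
  MvPolynomial.eval (fun i => x i) (P : MvPolynomial (Fin N) ℝ)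

/-- The hyperplane with equation `⟨n, x⟩ - c = 0`. -/
def hyperplane {N : ℕ} (n : E N) (c : ℝ) : Set (E N) :=
  {x | inner ℝ n x - c = 0}

/-- A family of `d` distinct hyperplanes of `ℝ^N` is in general position if any `N` of them meet
in exactly one point, and different `N`-subfamilies give different points. -/
structure InGeneralPosition {N d : ℕ} (ℓ : Fin d → Set (E N)) : Prop where
  distinct : Function.Injective ℓ
  singleton : ∀ H : Finset (Fin d), H.card = N → ∃ θ : E N, ⋂ i ∈ H, ℓ i = {θ}
  one_to_one : ∀ H H' : Finset (Fin d), H.card = N → H'.card = N →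
    ⋂ i ∈ H, ℓ i = ⋂ i ∈ H', ℓ i → H = H'

/-- The lattice of all the points at which `N` hyperplanes of the family meet. -/
def lattice {N d : ℕ} (ℓ : Fin d → Set (E N)) : Set (E N) :=
  {θ | ∃ H : Finset (Fin d), H.card = N ∧ ⋂ i ∈ H, ℓ i = {θ}}

/-- `A` is an interpolation lattice of degree `m`: every function on `A` is interpolated by exactly
one polynomial of degree at most `m`. -/
def IsInterpolationLattice {N : ℕ} (m : ℕ) (A : Set (E N)) : Prop :=
  ∀ f : E N → ℝ, ∃! P : PolyLE N m, ∀ a ∈ A, evalAt P a = f a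

/-- The Lagrange interpolation polynomial of `f` at an interpolation lattice `A` of degree `m`. -/
def lagrange {N m : ℕ} {A : Set (E N)} (hA : IsInterpolationLattice m A) (f : E N → ℝ) :
    PolyLE N m :=
  (hA f).choose

theorem lagrange_evalAt {N m : ℕ} {A : Set (E N)} (hA : IsInterpolationLattice m A)
    (f : E N → ℝ) {a : E N} (ha : a ∈ A) : evalAt (lagrange hA f) a = f a :=
  (hA f).choose_spec.1 a ha

/-- The Taylor polynomial of `f` at the origin to the order `m`,
`∑_{k ≤ m} (1 / k!) ∑_{j_1, …, j_k} D^k f(0)(e_{j_1}, …, e_{j_k}) X_{j_1} ⋯ X_{j_k}`. -/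
def taylorPoly {N : ℕ} (m : ℕ) (f : E N → ℝ) : MvPolynomial (Fin N) ℝ :=
  ∑ k ∈ Finset.range (m + 1), ∑ j : Fin k → Fin N,
    MvPolynomial.C ((k.factorial : ℝ)⁻¹ *
        iteratedFDeriv ℝ k f 0 (fun i => EuclideanSpace.single (j i) (1 : ℝ))) *
      ∏ i : Fin k, MvPolynomial.X (j i)

theorem taylorPoly_mem {N : ℕ} (m : ℕ) (f : E N → ℝ) : taylorPoly m f ∈ PolyLE N m := by
  refine Submodule.sum_mem _ fun k hk => Submodule.sum_mem _ fun j _ => ?_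
  rw [MvPolynomial.mem_restrictTotalDegree]
  refine (MvPolynomial.totalDegree_mul _ _).trans ?_
  rw [MvPolynomial.totalDegree_C, zero_add]
  refine (MvPolynomial.totalDegree_finsetProd _ _).trans ?_
  have hk' := Finset.mem_range.1 hk
  simp
  omega

/-- The Taylor polynomial as an element of the space of polynomials of degree at most `m`. -/
def taylor {N : ℕ} (m : ℕ) (f : E N → ℝ) : PolyLE N m :=
  ⟨taylorPoly m f, taylorPoly_mem m f⟩

/-- The value of the Taylor polynomial is `∑_{k ≤ m} (1 / k!) D^k f(0)(x, …, x)`. -/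
theorem taylor_evalAt {N : ℕ} (m : ℕ) (f : E N → ℝ) (x : E N) :
    evalAt (taylor m f) x =
      ∑ k ∈ Finset.range (m + 1), (k.factorial : ℝ)⁻¹ * iteratedFDeriv ℝ k f 0 (fun _ => x) := by
  have hx : x = ∑ i, x i • EuclideanSpace.single i (1 : ℝ) := by
    ext k
    simp [Finset.sum_apply, Pi.single_apply]
  have key : ∀ k : ℕ, iteratedFDeriv ℝ k f 0 (fun _ => x) =
      ∑ j : Fin k → Fin N, (∏ i, x (j i)) *
        iteratedFDeriv ℝ k f 0 (fun i => EuclideanSpace.single (j i) (1 : ℝ)) := by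
    intro k
    conv_lhs => rw [hx]
    rw [ContinuousMultilinearMap.map_sum]
    refine Finset.sum_congr rfl fun j _ => ?_
    rw [ContinuousMultilinearMap.map_smul_univ, smul_eq_mul]
  simp only [evalAt, taylor, taylorPoly, map_sum, map_mul, map_prod, MvPolynomial.eval_C,
    MvPolynomial.eval_X]
  refine Finset.sum_congr rfl fun k _ => ?_
  rw [key, Finset.mul_sum]
  refine Finset.sum_congr rfl fun j _ => ?_
  ring

end ChungYao

end

/-!
Let `g` be `f` minus its Taylor polynomial, so that the interpolants of `f` minus that polynomial
are the interpolants of `g`, and all derivatives of `g` up to the order `d - N` vanish at the origin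
in every direction. Adding the hyperplanes one at a time, as in Newton's interpolation formula, the
interpolant at the vertices of `S ∪ {a}` is that of `S` plus a sum, over the sets `K ⊆ S` of `N - 1`
hyperplanes, of multiples of the products of the affine forms in `S \ K`. On the line `⋂ i ∈ K, ℓ i`
the leading coefficient of the new interpolant is a divided difference of `g`, hence a directional
derivative of `g` at a point close to the origin. The direction of that line is a cross product of
the normals in `K`, and by (C2) its inner products with the other normals are bounded below, so the
coefficients of the correction tend to zero.
-/

noncomputable section

namespace ChungYao

section MeanValue

theorem exists_finset_deriv_eq_zero {I : Set ℝ} (hI : I.OrdConnected) {f : ℝ → ℝ}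
    (hf : ContinuousOn f I) {k : ℕ} {Z : Finset ℝ} (hZ : Z.card = k + 1) (hZI : ∀ z ∈ Z, z ∈ I)
    (hfZ : ∀ z ∈ Z, f z = 0) :
    ∃ Z' : Finset ℝ, Z'.card = k ∧ (∀ z ∈ Z', z ∈ I) ∧ ∀ z ∈ Z', deriv f z = 0 := by
  let e := Z.orderEmbOfFin hZ
  have heZ (i : Fin (k + 1)) : e i ∈ Z := Z.orderEmbOfFin_mem hZ i
  have hsub (i : Fin k) : Set.Icc (e i.castSucc) (e i.succ) ⊆ I :=
    hI.out (hZI _ (heZ _)) (hZI _ (heZ _))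
  have hroot (i : Fin k) : ∃ y ∈ Set.Ioo (e i.castSucc) (e i.succ), deriv f y = 0 :=
    exists_deriv_eq_zero (e.strictMono i.castSucc_lt_succ) (hf.mono (hsub i))
      ((hfZ _ (heZ _)).trans (hfZ _ (heZ _)).symm)
  choose y hy hy0 using hroot
  have hmono : StrictMono y := fun i j hij =>
    calc y i < e i.succ := (hy i).2
      _ ≤ e j.castSucc := e.monotone (Fin.succ_le_castSucc_iff.2 hij)
      _ < y j := (hy j).1
  refine ⟨Finset.univ.map ⟨y, hmono.injective⟩, by simp, ?_, ?_⟩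
  · simpa using fun i => hsub i (Set.Ioo_subset_Icc_self (hy i))
  · simpa using hy0

theorem exists_iteratedDeriv_eq_zero {I : Set ℝ} (hI : I.OrdConnected) {k : ℕ} {f : ℝ → ℝ}
    (hf : ∀ t ∈ I, ContDiffAt ℝ k f t) {Z : Finset ℝ} (hZ : Z.card = k + 1)
    (hZI : ∀ z ∈ Z, z ∈ I) (hfZ : ∀ z ∈ Z, f z = 0) : ∃ ξ ∈ I, iteratedDeriv k f ξ = 0 := by
  induction k generalizing f Z with
  | zero =>
    obtain ⟨z, hz⟩ := Finset.card_pos.1 (by omega : 0 < Z.card)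
    exact ⟨z, hZI z hz, by rw [iteratedDeriv_zero, hfZ z hz]⟩
  | succ k ih =>
    have hcont : ContinuousOn f I := fun t ht => (hf t ht).continuousAt.continuousWithinAt
    obtain ⟨Z', hZ', hZI', hfZ'⟩ := exists_finset_deriv_eq_zero hI hcont hZ hZI hfZ
    rw [iteratedDeriv_succ']
    exact ih (fun t ht => (hf t ht).derivWithin (by norm_cast)) hZ' hZI' hfZ'

open Polynomial in
theorem iteratedDeriv_polynomial_eval {𝕜 : Type*} [NontriviallyNormedField 𝕜] (q : 𝕜[X]) (k : ℕ) :
    iteratedDeriv k (fun t => q.eval t) = fun t => (derivative^[k] q).eval t := by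
  induction k generalizing q with
  | zero => rfl
  | succ k ih =>
    have hderiv : deriv (fun t => q.eval t) = fun t => (derivative q).eval t :=
      funext fun _ => q.deriv
    rw [iteratedDeriv_succ', hderiv, ih, Function.iterate_succ_apply]

open Polynomial in
theorem iterate_derivative_eq_C {R : Type*} [Semiring R] {q : R[X]} {k : ℕ}
    (hq : q.natDegree ≤ k) : derivative^[k] q = C (k.factorial • q.coeff k) := by
  have hdeg : (derivative^[k] q).natDegree ≤ 0 :=
    (natDegree_iterate_derivative q k).trans (by omega)
  rw [eq_C_of_natDegree_le_zero hdeg, coeff_iterate_derivative, zero_add, Nat.descFactorial_self]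

-- `q.coeff k` is the divided difference of `f` at the nodes `Z`.
open Polynomial in
theorem exists_iteratedDeriv_eq_coeff {I : Set ℝ} (hI : I.OrdConnected) {k : ℕ} {f : ℝ → ℝ}
    (hf : ∀ t ∈ I, ContDiffAt ℝ k f t) {Z : Finset ℝ} (hZ : Z.card = k + 1)
    (hZI : ∀ z ∈ Z, z ∈ I) {q : ℝ[X]} (hq : q.natDegree ≤ k) (hqZ : ∀ z ∈ Z, q.eval z = f z) :
    ∃ ξ ∈ I, iteratedDeriv k f ξ = k.factorial * q.coeff k := by
  have hqd (t : ℝ) : ContDiffAt ℝ k (fun t => q.eval t) t := (q.contDiff_aeval k).contDiffAt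
  obtain ⟨ξ, hξ, hξ0⟩ := exists_iteratedDeriv_eq_zero hI (f := f - fun t => q.eval t)
    (fun t ht => (hf t ht).sub (hqd t)) hZ hZI fun z hz => sub_eq_zero.2 (hqZ z hz).symm
  refine ⟨ξ, hξ, ?_⟩
  rw [iteratedDeriv_sub (hf ξ hξ) (hqd ξ), iteratedDeriv_polynomial_eval,
    iterate_derivative_eq_C hq, sub_eq_zero] at hξ0
  simpa only [eval_C, nsmul_eq_mul] using hξ0

end MeanValue

section DirectionalDerivative

variable {𝕜 V W : Type*} [NontriviallyNormedField 𝕜] [NormedAddCommGroup V] [NormedSpace 𝕜 V]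
  [NormedAddCommGroup W] [NormedSpace 𝕜 W]

theorem iteratedDeriv_comp_add_smul {f : V → W} {x v : V} {k : ℕ} {t : 𝕜}
    (hf : ContDiffAt 𝕜 k f (x + t • v)) :
    iteratedDeriv k (fun s : 𝕜 => f (x + s • v)) t =
      iteratedFDeriv 𝕜 k f (x + t • v) fun _ => v := by
  induction k generalizing t with
  | zero => simp
  | succ k ih =>
    have hline : ContinuousAt (fun s : 𝕜 => x + s • v) t := by fun_prop
    have hev : iteratedDeriv k (fun s : 𝕜 => f (x + s • v)) =ᶠ[𝓝 t]
        fun s => iteratedFDeriv 𝕜 k f (x + s • v) fun _ => v := by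
      filter_upwards [hline.eventually (hf.eventually (by simp))] with s hs
      exact ih (hs.of_le (by exact_mod_cast Nat.le_succ k))
    rw [iteratedDeriv_succ, hev.deriv_eq]
    exact ContDiffAt.deriv_fderiv_add_smul (by exact_mod_cast hf)

theorem eventually_norm_iteratedFDeriv_le {g : V → W} {x : V} {k : ℕ} (hg : ContDiffAt 𝕜 k g x)
    (hg0 : ∀ v, (iteratedFDeriv 𝕜 k g x fun _ => v) = 0) {ε : ℝ} (hε : 0 < ε) :
    ∀ᶠ y in 𝓝 x, ∀ v, ‖v‖ ≤ 1 → ‖iteratedFDeriv 𝕜 k g y fun _ => v‖ ≤ ε := by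
  have hcont : ContinuousAt (iteratedFDeriv 𝕜 k g) x := hg.continuousAt_iteratedFDeriv le_rfl
  filter_upwards [hcont.eventually (Metric.ball_mem_nhds _ hε)] with y hy v hv
  rw [dist_eq_norm] at hy
  have hdiff : (iteratedFDeriv 𝕜 k g y fun _ => v) =
      (iteratedFDeriv 𝕜 k g y - iteratedFDeriv 𝕜 k g x) fun _ => v := by
    rw [_root_.sub_apply, hg0, sub_zero]
  calc ‖iteratedFDeriv 𝕜 k g y fun _ => v‖
      ≤ ‖iteratedFDeriv 𝕜 k g y - iteratedFDeriv 𝕜 k g x‖ * ∏ _i : Fin k, ‖v‖ :=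
        hdiff ▸ ContinuousMultilinearMap.le_opNorm _ _
    _ ≤ ε * 1 := by
        rw [Finset.prod_const]
        gcongr
        exact pow_le_one₀ (norm_nonneg v) hv
    _ = ε := mul_one ε

end DirectionalDerivative

section CrossProduct

variable {V : Type*} [NormedAddCommGroup V] [InnerProductSpace ℝ V]
  [FiniteDimensional ℝ V] {M : ℕ} [Fact (Module.finrank ℝ V = M + 1)]

/-- The generalized cross product of `M` vectors of an oriented space of dimension `M + 1`: the
vector representing the linear form `w ↦ vol (w, u_1, …, u_M)`. -/
def crossProduct (o : Orientation ℝ V (Fin (M + 1))) (u : Fin M → V) : V :=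
  have := FiniteDimensional.complete ℝ V
  (InnerProductSpace.toDual ℝ V).symm
    (o.volumeForm.toMultilinearMap.toLinearMap (Fin.cons 0 u) 0).toContinuousLinearMap

variable (o : Orientation ℝ V (Fin (M + 1))) (u : Fin M → V)

theorem inner_crossProduct (w : V) :
    inner ℝ w (crossProduct o u) = o.volumeForm (Fin.cons w u) := by
  have := FiniteDimensional.complete ℝ V
  rw [crossProduct, real_inner_comm, InnerProductSpace.toDual_symm_apply]
  exact congrArg o.volumeForm (Fin.update_cons_zero (α := fun _ => V) 0 u w)

theorem inner_self_crossProduct (i : Fin M) : inner ℝ (u i) (crossProduct o u) = 0 := by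
  rw [inner_crossProduct]
  exact o.volumeForm.map_eq_zero_of_eq _ (i := 0) (j := i.succ) (by simp) (Fin.succ_ne_zero i).symm

theorem norm_crossProduct_le : ‖crossProduct o u‖ ≤ ∏ i, ‖u i‖ := by
  set v := crossProduct o u
  have hsq : ‖v‖ * ‖v‖ ≤ ‖v‖ * ∏ i, ‖u i‖ :=
    calc ‖v‖ * ‖v‖ = o.volumeForm (Fin.cons v u) := by
          rw [← real_inner_self_eq_norm_mul_norm, inner_crossProduct]
      _ ≤ ∏ i, ‖(Fin.cons v u : Fin (M + 1) → V) i‖ := o.volumeForm_apply_le _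
      _ = ‖v‖ * ∏ i, ‖u i‖ := by simp only [Fin.prod_univ_succ, Fin.cons_zero, Fin.cons_succ]
  rcases (norm_nonneg v).eq_or_lt with hv | hv
  · exact hv ▸ Finset.prod_nonneg fun i _ => norm_nonneg (u i)
  · exact le_of_mul_le_mul_left hsq hv

theorem abs_inner_crossProduct [MeasurableSpace V] [BorelSpace V] (w : V) :
    |inner ℝ w (crossProduct o u)| =
      (volume : Measure V).real (parallelepiped (Fin.cons w u : Fin (M + 1) → V)) := by
  rw [inner_crossProduct, ← o.measure_eq_volume, Measure.real,
    AlternatingMap.measure_parallelepiped, ENNReal.toReal_ofReal (abs_nonneg _)]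

end CrossProduct

theorem le_volume_of_injective {V : Type*} [AddCommGroup V] [Module ℝ V] [MeasureSpace V]
    {ι : Type*} [LinearOrder ι] {N : ℕ} {n : ι → V} {δ : ℝ}
    (h : ∀ i : Fin N → ι, StrictMono i →
      δ ≤ (volume : Measure V).real (parallelepiped fun k => n (i k)))
    (i : Fin N → ι) (hi : Function.Injective i) :
    δ ≤ (volume : Measure V).real (parallelepiped fun k => n (i k)) := by
  have hmono : StrictMono (i ∘ Tuple.sort i) :=
    (Tuple.monotone_sort i).strictMono_of_injective (hi.comp (Tuple.sort i).injective)
  rw [← parallelepiped_comp_equiv _ (Tuple.sort i)]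
  exact h _ hmono

theorem exists_transversal_direction {ι : Type*} {N : ℕ} {n : ι → E N} (hn : ∀ i, ‖n i‖ ≤ 1)
    {δ : ℝ} (hδ : ∀ i : Fin N → ι, Function.Injective i →
      δ ≤ (volume : Measure (E N)).real (parallelepiped fun k => n (i k)))
    {K : Finset ι} (hK : K.card + 1 = N) :
    ∃ v : E N, ‖v‖ ≤ 1 ∧ (∀ i ∈ K, inner ℝ (n i) v = 0) ∧ ∀ i ∉ K, δ ≤ |inner ℝ (n i) v| := by
  subst hK
  have : Fact (Module.finrank ℝ (E (K.card + 1)) = K.card + 1) := ⟨finrank_euclideanSpace_fin⟩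
  let o := (EuclideanSpace.basisFun (Fin (K.card + 1)) ℝ).toBasis.orientation
  let e := K.equivFin.symm
  let u : Fin K.card → E (K.card + 1) := fun k => n (e k)
  refine ⟨crossProduct o u, ?_, fun i hi => ?_, fun i hi => ?_⟩
  · exact (norm_crossProduct_le o u).trans
      (Finset.prod_le_one (fun _ _ => norm_nonneg _) fun k _ => hn (e k))
  · simpa [u, e] using inner_self_crossProduct o u (K.equivFin ⟨i, hi⟩)
  · have hinj : Function.Injective (Fin.cons i fun k => ↑(e k) : Fin (K.card + 1) → ι) :=
      Fin.cons_injective_iff.2 ⟨fun ⟨k, hk⟩ => hi (hk ▸ (e k).2),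
        Subtype.val_injective.comp e.injective⟩
    have hcons : (fun k => n ((Fin.cons i fun k => ↑(e k) : Fin (K.card + 1) → ι) k)) =
        Fin.cons (n i) u := Fin.comp_cons n i fun k => ↑(e k)
    rw [abs_inner_crossProduct, ← hcons]
    exact hδ _ hinj

section TotalDegree

/-- Homogenization of exponents: the monomials of degree at most `m` in the variables `σ` correspond
to the monomials of degree `m` in the variables `Option σ`. -/
def degreeLEEquiv (σ : Type*) [Fintype σ] (m : ℕ) :
    {s : σ →₀ ℕ | (s.sum fun _ e => e) ≤ m} ≃ {P : Option σ → ℕ // ∑ o, P o = m} where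
  toFun s := ⟨fun o => o.elim (m - s.1.sum fun _ e => e) s.1, by
    have hs : (s.1.sum fun _ e => e) = ∑ i, s.1 i := Finsupp.sum_fintype _ _ fun _ => rfl
    simpa only [Fintype.sum_option, Option.elim, ← hs] using Nat.sub_add_cancel s.2⟩
  invFun P := ⟨Finsupp.equivFunOnFinite.symm fun i => P.1 (some i), by
    rw [Set.mem_ofPred_eq, Finsupp.sum_fintype _ _ fun _ => rfl]
    exact (Nat.le_add_left _ _).trans (Fintype.sum_option P.1 ▸ P.2).le⟩
  left_inv s := by ext; simp
  right_inv P := by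
    have hP : P.1 none + ∑ i, P.1 (some i) = m := Fintype.sum_option P.1 ▸ P.2
    ext (_ | i)
    · simpa [Finsupp.sum_fintype] using Nat.sub_eq_of_eq_add hP.symm
    · simp

theorem finrank_restrictTotalDegree (σ R : Type*) [Fintype σ] [CommRing R] [Nontrivial R] (m : ℕ) :
    Module.finrank R (MvPolynomial.restrictTotalDegree σ R m) = (Fintype.card σ + m).choose m := by
  classical
  let e := (degreeLEEquiv σ m).trans (Sym.equivNatSumOfFintype (Option σ) m).symm
  have := Fintype.ofEquiv _ e.symm
  have hcard : Fintype.card σ + 1 + m - 1 = Fintype.card σ + m := by omega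
  have hfinrank := Module.finrank_eq_card_basis
    (MvPolynomial.basisRestrictSupport R {s : σ →₀ ℕ | (s.sum fun _ e => e) ≤ m})
  rwa [Fintype.card_congr e, Sym.card_sym_eq_choose, Fintype.card_option, hcard] at hfinrank

end TotalDegree

section Seminorm

variable {α 𝕜 V : Type*} [NormedField 𝕜] [AddCommGroup V] [Module 𝕜 V] {l : Filter α} {u : α → V}

theorem tendsto_seminorm_of_repr {ι : Type*} [Finite ι] (b : Module.Basis ι 𝕜 V)
    (hu : ∀ i, Tendsto (fun s => b.repr (u s) i) l (𝓝 0)) (p : Seminorm 𝕜 V) :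
    Tendsto (fun s => p (u s)) l (𝓝 0) := by
  have := Fintype.ofFinite ι
  have hle (s : α) : p (u s) ≤ ∑ i, ‖b.repr (u s) i‖ * p (b i) :=
    calc p (u s) = p (∑ i, b.repr (u s) i • b i) := by rw [b.sum_repr]
      _ ≤ ∑ i, p (b.repr (u s) i • b i) :=
        Finset.le_sum_of_subadditive p (map_zero p).le (map_add_le_add p) _ _
      _ = ∑ i, ‖b.repr (u s) i‖ * p (b i) := by simp only [map_smul_eq_mul]
  refine squeeze_zero (fun s => apply_nonneg p _) hle ?_
  simpa using tendsto_finsetSum Finset.univ fun i _ => (hu i).norm.mul_const (p (b i))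

theorem tendsto_seminorm_of_separating [FiniteDimensional 𝕜 V] {Φ : Set (Module.Dual 𝕜 V)}
    (hΦ : ∀ v, (∀ φ ∈ Φ, φ v = 0) → v = 0)
    (hu : ∀ φ ∈ Φ, Tendsto (fun s => φ (u s)) l (𝓝 0)) (p : Seminorm 𝕜 V) :
    Tendsto (fun s => p (u s)) l (𝓝 0) := by
  have hspan : Submodule.span 𝕜 Φ = ⊤ := by
    have hco : (Submodule.span 𝕜 Φ).dualCoannihilator = ⊥ := (Submodule.eq_bot_iff _).2 fun v hv =>
      hΦ v fun φ hφ => (Submodule.mem_dualCoannihilator v).1 hv φ (Submodule.subset_span hφ)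
    rw [← Subspace.dualCoannihilator_dualAnnihilator_eq (W := Submodule.span 𝕜 Φ), hco,
      Submodule.dualAnnihilator_bot]
  have hdual (φ : Module.Dual 𝕜 V) : Tendsto (fun s => φ (u s)) l (𝓝 0) := by
    have hφ : φ ∈ Submodule.span 𝕜 Φ := hspan ▸ Submodule.mem_top
    induction hφ using Submodule.span_induction with
    | mem φ hφ => exact hu φ hφ
    | zero => simpa using tendsto_const_nhds
    | add φ ψ _ _ hφ hψ => simpa using hφ.add hψ
    | smul a φ _ hφ => simpa using hφ.const_mul a
  let b := Module.finBasis 𝕜 V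
  exact tendsto_seminorm_of_repr b (fun i => hdual (b.coord i)) p

end Seminorm

section EvalAt

variable {N m : ℕ}

theorem totalDegree_coe_le (P : PolyLE N m) : (P : MvPolynomial (Fin N) ℝ).totalDegree ≤ m :=
  (MvPolynomial.mem_restrictTotalDegree _ _ _).1 P.2

theorem evalAt_add (P Q : PolyLE N m) (x : E N) : evalAt (P + Q) x = evalAt P x + evalAt Q x :=
  map_add (MvPolynomial.eval _) P.1 Q.1

/-- `evalAt` as a linear form in the polynomial. -/
def evalₗ (x : E N) : PolyLE N m →ₗ[ℝ] ℝ :=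
  (MvPolynomial.aeval fun i => x i).toLinearMap ∘ₗ (PolyLE N m).subtype

theorem evalₗ_apply (x : E N) (P : PolyLE N m) : evalₗ x P = evalAt P x := by
  simp [evalₗ, evalAt]

theorem eq_zero_of_evalAt {P : PolyLE N m} (hP : ∀ x, evalAt P x = 0) : P = 0 :=
  Subtype.ext <| MvPolynomial.funext fun x => by
    simpa [evalAt] using hP (WithLp.toLp 2 x)

theorem tendsto_seminorm_of_evalAt {α : Type*} {l : Filter α} {P : α → PolyLE N m}
    (hP : ∀ x, Tendsto (fun s => evalAt (P s) x) l (𝓝 0)) (p : Seminorm ℝ (PolyLE N m)) :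
    Tendsto (fun s => p (P s)) l (𝓝 0) := by
  refine tendsto_seminorm_of_separating (Φ := Set.range evalₗ) (fun Q hQ => ?_) ?_ p
  · exact eq_zero_of_evalAt fun x => evalₗ_apply x Q ▸ hQ _ ⟨x, rfl⟩
  · simpa only [Set.forall_mem_range, evalₗ_apply] using hP

end EvalAt

section AffineForm

variable {N : ℕ}

/-- The polynomial `⟨n, x⟩ - c`. -/
def affineForm (n : E N) (c : ℝ) : MvPolynomial (Fin N) ℝ :=
  ∑ i, MvPolynomial.C (n i) * MvPolynomial.X i - MvPolynomial.C c

theorem eval_affineForm (n : E N) (c : ℝ) (x : E N) :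
    MvPolynomial.eval (fun i => x i) (affineForm n c) = inner ℝ n x - c := by
  simp [affineForm, PiLp.inner_apply, mul_comm]

theorem totalDegree_affineForm_le (n : E N) (c : ℝ) : (affineForm n c).totalDegree ≤ 1 := by
  refine (MvPolynomial.totalDegree_sub_C_le _ _).trans ?_
  refine MvPolynomial.totalDegree_finsetSum_le fun i _ => ?_
  refine (MvPolynomial.totalDegree_mul _ _).trans ?_
  rw [MvPolynomial.totalDegree_C, MvPolynomial.totalDegree_X]

variable {ι : Type*} (n : ι → E N) (c : ι → ℝ) (A : Finset ι)

/-- The product of the affine forms `⟨n i, x⟩ - c i` with `i ∈ A`, a polynomial vanishing on the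
hyperplanes with index in `A`. -/
def formProd : MvPolynomial (Fin N) ℝ :=
  ∏ i ∈ A, affineForm (n i) (c i)

theorem eval_formProd (x : E N) :
    MvPolynomial.eval (fun i => x i) (formProd n c A) = ∏ i ∈ A, (inner ℝ (n i) x - c i) := by
  simp only [formProd, map_prod, eval_affineForm]

theorem formProd_mem {m : ℕ} (hA : A.card ≤ m) : formProd n c A ∈ PolyLE N m := by
  rw [MvPolynomial.mem_restrictTotalDegree]
  calc (formProd n c A).totalDegree ≤ ∑ i ∈ A, (affineForm (n i) (c i)).totalDegree :=
        MvPolynomial.totalDegree_finsetProd _ _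
    _ ≤ A.card • 1 := Finset.sum_le_card_nsmul _ _ 1 fun i _ => totalDegree_affineForm_le _ _
    _ ≤ m := by simpa using hA

end AffineForm

section RestrictLine

open Polynomial

/-- The restriction of a polynomial to the line `x + t v`, as a polynomial in the parameter `t`. -/
def restrictLine {N : ℕ} (x v : E N) : MvPolynomial (Fin N) ℝ →ₐ[ℝ] ℝ[X] :=
  MvPolynomial.aeval fun i => C (v i) * X + C (x i)

variable {N : ℕ} (x v : E N)

theorem eval_restrictLine (P : MvPolynomial (Fin N) ℝ) (t : ℝ) :
    (restrictLine x v P).eval t = MvPolynomial.eval (fun i => (x + t • v) i) P := by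
  rw [restrictLine, MvPolynomial.aeval_def, MvPolynomial.polynomial_eval_eval₂, MvPolynomial.eval,
    MvPolynomial.coe_eval₂Hom]
  congr 1
  · ext r; simp
  · funext i; simp; ring

theorem natDegree_restrictLine_le {P : MvPolynomial (Fin N) ℝ} {k : ℕ} (hP : P.totalDegree ≤ k) :
    (restrictLine x v P).natDegree ≤ k :=
  (MvPolynomial.aeval_natDegree_le P hP (fun i => C (v i) * X + C (x i))
    fun _ => natDegree_linear_le).trans_eq (mul_one k)

theorem restrictLine_affineForm (n : E N) (c : ℝ) :
    restrictLine x v (affineForm n c) = C (inner ℝ n v) * X + C (inner ℝ n x - c) :=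
  Polynomial.funext fun t => by
    rw [eval_restrictLine, eval_affineForm, inner_add_right, inner_smul_right]
    simp only [eval_add, eval_mul, eval_C, eval_X]
    ring

theorem coeff_restrictLine_formProd {ι : Type*} (n : ι → E N) (c : ι → ℝ) (A : Finset ι) :
    (restrictLine x v (formProd n c A)).coeff A.card = ∏ i ∈ A, inner ℝ (n i) v := by
  simp only [formProd, map_prod, restrictLine_affineForm]
  rw [← mul_one A.card, coeff_prod_of_natDegree_le _ _ 1 fun _ _ => natDegree_linear_le]
  simp

end RestrictLine

/-- `θ` sends each `N`-element set `H` of indices to the only common point of the hyperplanes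
`⟨n i, x⟩ = c i` with `i ∈ H`, and no other hyperplane of the family passes through it. The values
of `θ` at sets of other sizes are irrelevant. -/
structure IsVertexMap {N : ℕ} {ι : Type*} (n : ι → E N) (c : ι → ℝ) (θ : Finset ι → E N) :
    Prop where
  inner_sub_eq_zero_iff {H : Finset ι} (hH : H.card = N) {i : ι} :
    inner ℝ (n i) (θ H) - c i = 0 ↔ i ∈ H
  eq_vertex {H : Finset ι} (hH : H.card = N) {x : E N} (hx : ∀ i ∈ H, inner ℝ (n i) x - c i = 0) :
    x = θ H

section GeneralPosition

variable {N d : ℕ} {n : Fin d → E N} {c : Fin d → ℝ} {θ : Finset (Fin d) → E N}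

theorem InGeneralPosition.isVertexMap (h : InGeneralPosition fun i => hyperplane (n i) (c i))
    (hN : 0 < N) (hθ : ∀ H : Finset (Fin d), H.card = N → ⋂ i ∈ H, hyperplane (n i) (c i) = {θ H}) :
    IsVertexMap n c θ := by
  have heq {H : Finset (Fin d)} (hH : H.card = N) {x : E N}
      (hx : ∀ i ∈ H, inner ℝ (n i) x - c i = 0) : x = θ H := by
    have hx' : x ∈ ⋂ i ∈ H, hyperplane (n i) (c i) := Set.mem_iInter₂.2 hx
    rwa [hθ H hH] at hx'
  have hzero {H : Finset (Fin d)} (hH : H.card = N) : ∀ i ∈ H, inner ℝ (n i) (θ H) - c i = 0 := by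
    have hx : θ H ∈ ⋂ i ∈ H, hyperplane (n i) (c i) := by rw [hθ H hH, Set.mem_singleton_iff]
    exact fun i hi => Set.mem_iInter₂.1 hx i hi
  refine ⟨fun {H} hH {i} => ⟨fun hi => ?_, hzero hH i⟩, heq⟩
  by_contra hiH
  obtain ⟨a, ha⟩ := Finset.card_pos.1 (hH ▸ hN)
  have hcard : (insert i (H.erase a)).card = N := by
    rw [Finset.card_insert_of_notMem fun hm => hiH (Finset.mem_of_mem_erase hm),
      Finset.card_erase_add_one ha, hH]
  have hvertex : θ H = θ (insert i (H.erase a)) := heq hcard <|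
    (Finset.forall_mem_insert _ _ _).2 ⟨hi, fun j hj => hzero hH j (Finset.mem_of_mem_erase hj)⟩
  have hsets := h.one_to_one H _ hH hcard (by rw [hθ H hH, hθ _ hcard, hvertex])
  exact hiH (hsets ▸ Finset.mem_insert_self i _)

theorem lattice_eq_image
    (hθ : ∀ H : Finset (Fin d), H.card = N → ⋂ i ∈ H, hyperplane (n i) (c i) = {θ H}) :
    lattice (fun i => hyperplane (n i) (c i)) = θ '' {H | H.card = N} := by
  ext x
  refine exists_congr fun H => and_congr_right fun hH => ?_
  rw [hθ H hH, Set.singleton_eq_singleton_iff]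

end GeneralPosition

namespace IsVertexMap

variable {N : ℕ} {ι : Type*} {n : ι → E N} {c : ι → ℝ} {θ : Finset ι → E N}

theorem injOn (h : IsVertexMap n c θ) : Set.InjOn θ {H | H.card = N} := fun H hH H' hH' heq => by
  ext i
  rw [← h.inner_sub_eq_zero_iff hH, heq, h.inner_sub_eq_zero_iff hH']

theorem prod_eq_zero_iff (h : IsVertexMap n c θ) {H : Finset ι} (hH : H.card = N) (A : Finset ι) :
    ∏ i ∈ A, (inner ℝ (n i) (θ H) - c i) = 0 ↔ ¬Disjoint A H := by
  simp only [Finset.prod_eq_zero_iff, h.inner_sub_eq_zero_iff hH, Finset.not_disjoint_iff]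

end IsVertexMap

section InterpolationLattice

theorem lagrange_eq {N m : ℕ} {A : Set (E N)} (hA : IsInterpolationLattice m A) {f : E N → ℝ}
    {P : PolyLE N m} (hP : ∀ a ∈ A, evalAt P a = f a) : lagrange hA f = P :=
  (hA f).unique (fun _ ha => lagrange_evalAt hA f ha) hP

variable {N m : ℕ} {ι : Type*} {n : ι → E N} {c : ι → ℝ} {θ : Finset ι → E N}

/-- The values of a polynomial at the points `θ H`, for all the `N`-element sets `H`. -/
def vertexEval (m : ℕ) (θ : Finset ι → E N) :
    PolyLE N m →ₗ[ℝ] ({H : Finset ι // H.card = N} → ℝ) :=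
  LinearMap.pi fun H => evalₗ (θ H)

theorem vertexEval_apply (P : PolyLE N m) (H : {H : Finset ι // H.card = N}) :
    vertexEval m θ P H = evalAt P (θ H) :=
  evalₗ_apply _ P

variable [Fintype ι]

namespace IsVertexMap

-- The fundamental Lagrange polynomial of `θ H` is proportional to the product of the forms `∉ H`.
theorem vertexEval_surjective (h : IsVertexMap n c θ) (hm : Fintype.card ι = N + m) :
    Function.Surjective (vertexEval m θ) := by
  classical
  have hmem (H : {H : Finset ι // H.card = N}) : formProd n c H.1ᶜ ∈ PolyLE N m :=
    formProd_mem n c _ (by rw [Finset.card_compl, H.2, hm, Nat.add_sub_cancel_left])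
  have heval (H H' : {H : Finset ι // H.card = N}) :
      vertexEval m θ ⟨_, hmem H⟩ H' = ∏ i ∈ H.1ᶜ, (inner ℝ (n i) (θ H') - c i) := by
    rw [vertexEval_apply, evalAt, eval_formProd]
  have hne (H : {H : Finset ι // H.card = N}) : vertexEval m θ ⟨_, hmem H⟩ H ≠ 0 := by
    rw [heval, Ne, h.prod_eq_zero_iff H.2, not_not]
    exact disjoint_compl_left
  have hzero {H H' : {H : Finset ι // H.card = N}} (hHH' : H ≠ H') :
      vertexEval m θ ⟨_, hmem H⟩ H' = 0 := by
    rw [heval, h.prod_eq_zero_iff H'.2, disjoint_compl_left_iff]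
    exact fun hle => hHH' (Subtype.ext
      (Finset.eq_of_subset_of_card_le hle (H.2.trans H'.2.symm).le).symm)
  intro φ
  refine ⟨∑ H, (φ H / vertexEval m θ ⟨_, hmem H⟩ H) • ⟨_, hmem H⟩, funext fun H' => ?_⟩
  rw [map_sum, Finset.sum_apply, Finset.sum_eq_single H']
  · rw [map_smul, Pi.smul_apply, smul_eq_mul, div_mul_cancel₀ _ (hne H')]
  · intro H _ hH
    rw [map_smul, Pi.smul_apply, hzero hH, smul_zero]
  · exact fun hH' => absurd (Finset.mem_univ H') hH'

theorem vertexEval_bijective (h : IsVertexMap n c θ) (hm : Fintype.card ι = N + m) :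
    Function.Bijective (vertexEval m θ) := by
  have hfinrank : Module.finrank ℝ (PolyLE N m) =
      Module.finrank ℝ ({H : Finset ι // H.card = N} → ℝ) := by
    rw [finrank_restrictTotalDegree, Module.finrank_fintype_fun_eq_card, Fintype.card_finset_len,
      hm, Fintype.card_fin, Nat.choose_symm_add]
  exact ⟨(LinearMap.injective_iff_surjective_of_finrank_eq_finrank hfinrank).2
    (h.vertexEval_surjective hm), h.vertexEval_surjective hm⟩

theorem isInterpolationLattice (h : IsVertexMap n c θ) (hm : Fintype.card ι = N + m) :
    IsInterpolationLattice m (θ '' {H | H.card = N}) := fun f => by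
  have hvalues (P : PolyLE N m) :
      vertexEval m θ P = (fun H : {H : Finset ι // H.card = N} => f (θ H)) ↔
        ∀ a ∈ θ '' {H | H.card = N}, evalAt P a = f a := by
    simp only [funext_iff, vertexEval_apply, Subtype.forall, Set.forall_mem_image,
      Set.mem_ofPred_eq]
  exact (existsUnique_congr hvalues).1 ((h.vertexEval_bijective hm).existsUnique _)

end IsVertexMap

end InterpolationLattice

section Newton

variable {N k : ℕ} {ι : Type*} [DecidableEq ι] {n : ι → E N} {c : ι → ℝ} {θ : Finset ι → E N}
  {g : E N → ℝ} {S K : Finset ι} {a : ι}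

theorem IsVertexMap.prod_sdiff_eq_zero_iff (h : IsVertexMap n c θ) (ha : a ∉ S)
    (hK : K.card + 1 = N) {H : Finset ι} (hHS : H ⊆ insert a S) (hH : H.card = N) :
    ∏ i ∈ S \ K, (inner ℝ (n i) (θ H) - c i) = 0 ↔ H ≠ insert a K := by
  rw [h.prod_eq_zero_iff hH, not_iff_not]
  refine ⟨fun hdisj => ?_, ?_⟩
  · have hHK : H ⊆ insert a K := by grind [Finset.disjoint_left]
    exact Finset.eq_of_subset_of_card_le hHK
      ((Finset.card_insert_le a K).trans (hK.trans hH.symm).le)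
  · rintro rfl
    grind [Finset.disjoint_left]

/-- The factor of `∏ i ∈ S \ K, (⟨n i, x⟩ - c i)` in the Newton correction of `Q`. -/
def newtonCoeff (n : ι → E N) (c : ι → ℝ) (θ : Finset ι → E N) (g : E N → ℝ) (S : Finset ι) (a : ι)
    (Q : PolyLE N k) (K : Finset ι) : ℝ :=
  (g (θ (insert a K)) - evalAt Q (θ (insert a K))) /
    ∏ i ∈ S \ K, (inner ℝ (n i) (θ (insert a K)) - c i)

theorem card_sdiff_eq_succ (hS : S.card = N + k) (hKS : K ⊆ S) (hK : K.card + 1 = N) :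
    (S \ K).card = k + 1 := by
  rw [Finset.card_sdiff_of_subset hKS]
  lia

/-- Newton's correction of a polynomial `Q` that interpolates `g` at the vertices of the subfamily
`S` of hyperplanes, into one that interpolates `g` at the vertices of `insert a S`. -/
def newtonStep (n : ι → E N) (c : ι → ℝ) (θ : Finset ι → E N) (g : E N → ℝ) (hS : S.card = N + k)
    (a : ι) (Q : PolyLE N k) : PolyLE N (k + 1) :=
  ⟨Q + ∑ K ∈ S.powerset with K.card + 1 = N, newtonCoeff n c θ g S a Q K • formProd n c (S \ K), by
    refine add_mem ((MvPolynomial.mem_restrictTotalDegree _ _ _).2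
      ((totalDegree_coe_le Q).trans k.le_succ)) (sum_mem fun K hK => ?_)
    rw [Finset.mem_filter, Finset.mem_powerset] at hK
    exact Submodule.smul_mem _ _ (formProd_mem n c _ (card_sdiff_eq_succ hS hK.1 hK.2).le)⟩

theorem evalAt_newtonStep (hS : S.card = N + k) (Q : PolyLE N k) (x : E N) :
    evalAt (newtonStep n c θ g hS a Q) x = evalAt Q x +
      ∑ K ∈ S.powerset with K.card + 1 = N,
        newtonCoeff n c θ g S a Q K * ∏ i ∈ S \ K, (inner ℝ (n i) x - c i) := by
  simp only [evalAt, newtonStep, map_add, map_sum, MvPolynomial.smul_eval, eval_formProd]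

theorem IsVertexMap.evalAt_newtonStep_eq (h : IsVertexMap n c θ) (hS : S.card = N + k) (ha : a ∉ S)
    {Q : PolyLE N k} (hQ : ∀ H ⊆ S, H.card = N → evalAt Q (θ H) = g (θ H)) {H : Finset ι}
    (hHS : H ⊆ insert a S) (hH : H.card = N) :
    evalAt (newtonStep n c θ g hS a Q) (θ H) = g (θ H) := by
  have hterm {K : Finset ι} (hK : K ∈ {K ∈ S.powerset | K.card + 1 = N}) :
      ∏ i ∈ S \ K, (inner ℝ (n i) (θ H) - c i) = 0 ↔ H ≠ insert a K :=
    h.prod_sdiff_eq_zero_iff ha (Finset.mem_filter.1 hK).2 hHS hH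
  rw [evalAt_newtonStep]
  by_cases haH : a ∈ H
  · have hmem : H.erase a ∈ {K ∈ S.powerset | K.card + 1 = N} := by
      rw [Finset.mem_filter, Finset.mem_powerset, Finset.card_erase_add_one haH]
      exact ⟨Finset.subset_insert_iff.1 hHS, hH⟩
    have hne : ∏ i ∈ S \ H.erase a, (inner ℝ (n i) (θ H) - c i) ≠ 0 :=
      (hterm hmem).not_left.2 (Finset.insert_erase haH).symm
    rw [Finset.sum_eq_single_of_mem _ hmem, newtonCoeff, Finset.insert_erase haH,
      div_mul_cancel₀ _ hne, add_sub_cancel]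
    intro K hK hKH
    rw [(hterm hK).2 fun hHK => hKH ?_, mul_zero]
    rw [hHK, Finset.erase_insert]
    exact fun haK => ha (Finset.mem_powerset.1 (Finset.mem_filter.1 hK).1 haK)
  · rw [Finset.sum_eq_zero, add_zero, hQ H ((Finset.subset_insert_iff_of_notMem haH).1 hHS) hH]
    intro K hK
    rw [(hterm hK).2 fun hHK => haH (hHK ▸ Finset.mem_insert_self a K), mul_zero]

theorem coeff_restrictLine_newtonStep (hS : S.card = N + k) (Q : PolyLE N k) (x : E N) {v : E N}
    (hKS : K ⊆ S) (hK : K.card + 1 = N) (hv : ∀ i ∈ K, inner ℝ (n i) v = 0) :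
    (restrictLine x v (newtonStep n c θ g hS a Q).1).coeff (k + 1) =
      newtonCoeff n c θ g S a Q K * ∏ i ∈ S \ K, inner ℝ (n i) v := by
  have hQ : (restrictLine x v Q.1).coeff (k + 1) = 0 :=
    Polynomial.coeff_eq_zero_of_natDegree_lt <| Nat.lt_succ_of_le <|
      natDegree_restrictLine_le x v (totalDegree_coe_le Q)
  have hprod {K' : Finset ι} (hK' : K' ∈ {K ∈ S.powerset | K.card + 1 = N}) :
      (restrictLine x v (formProd n c (S \ K'))).coeff (k + 1) = ∏ i ∈ S \ K', inner ℝ (n i) v := by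
    rw [Finset.mem_filter, Finset.mem_powerset] at hK'
    rw [← card_sdiff_eq_succ hS hK'.1 hK'.2, coeff_restrictLine_formProd]
  have hmem : K ∈ {K ∈ S.powerset | K.card + 1 = N} :=
    Finset.mem_filter.2 ⟨Finset.mem_powerset.2 hKS, hK⟩
  simp only [newtonStep, map_add, map_sum, map_smul, Polynomial.coeff_add, hQ, zero_add,
    Polynomial.finsetSum_coeff, Polynomial.coeff_smul, smul_eq_mul]
  rw [Finset.sum_eq_single_of_mem K hmem, hprod hmem]
  intro K' hK' hne
  obtain ⟨i, hiK, hiK'⟩ : ∃ i ∈ K, i ∉ K' := Finset.not_subset.1 fun hsub =>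
    hne (Finset.eq_of_subset_of_card_le hsub (by
      have := (Finset.mem_filter.1 hK').2
      lia)).symm
  rw [hprod hK', Finset.prod_eq_zero (Finset.mem_sdiff.2 ⟨hKS hiK, hiK'⟩) (hv i hiK), mul_zero]

end Newton

section NewtonBound

variable {N k : ℕ}

theorem exists_iteratedFDeriv_eq_coeff_restrictLine {U : Set (E N)} (hU : Convex ℝ U) {g : E N → ℝ}
    (hg : ∀ y ∈ U, ContDiffAt ℝ k g y) (P : PolyLE N k) {x v : E N} {Z : Finset ℝ}
    (hZ : Z.card = k + 1) (hZU : ∀ t ∈ Z, x + t • v ∈ U)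
    (hP : ∀ t ∈ Z, evalAt P (x + t • v) = g (x + t • v)) :
    ∃ y ∈ U, (iteratedFDeriv ℝ k g y fun _ => v) =
      k.factorial * (restrictLine x v P.1).coeff k := by
  have hI : Convex ℝ {t : ℝ | x + t • v ∈ U} :=
    (hU.translate_preimage_right x).linear_preimage (LinearMap.toSpanSingleton ℝ (E N) v)
  obtain ⟨t, ht, heq⟩ := exists_iteratedDeriv_eq_coeff hI.ordConnected
    (f := fun t => g (x + t • v)) (fun t ht => (hg _ ht).comp t (by fun_prop)) hZ hZU
    (natDegree_restrictLine_le x v (totalDegree_coe_le P))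
    fun t ht => (eval_restrictLine x v P.1 t).trans (hP t ht)
  exact ⟨_, ht, by rw [← heq, iteratedDeriv_comp_add_smul (hg _ ht)]⟩

namespace IsVertexMap

variable {ι : Type*} {n : ι → E N} {c : ι → ℝ} {θ : Finset ι → E N} {g : E N → ℝ}
  {S K : Finset ι} {x v : E N} {U : Set (E N)}

theorem add_smul_eq_vertex [DecidableEq ι] (h : IsVertexMap n c θ) (hK : K.card + 1 = N)
    (hx : ∀ j ∈ K, inner ℝ (n j) x - c j = 0) (hv : ∀ j ∈ K, inner ℝ (n j) v = 0) {i : ι}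
    (hi : i ∉ K) (hiv : inner ℝ (n i) v ≠ 0) :
    x + (-(inner ℝ (n i) x - c i) / inner ℝ (n i) v) • v = θ (insert i K) := by
  refine h.eq_vertex (by rw [Finset.card_insert_of_notMem hi, hK]) fun j hj => ?_
  rw [inner_add_right, inner_smul_right]
  rcases Finset.mem_insert.1 hj with rfl | hj
  · rw [div_mul_cancel₀ _ hiv]
    ring
  · rw [hv j hj, mul_zero, add_zero, hx j hj]

theorem insert_injOn [DecidableEq ι] (h : IsVertexMap n c θ) (hK : K.card + 1 = N) :
    Set.InjOn (fun i => θ (insert i K)) {i | i ∉ K} := fun i hi j hj hij => by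
  have hcard {i : ι} (hi : i ∉ K) : (insert i K).card = N := by
    rw [Finset.card_insert_of_notMem hi, hK]
  have hins : insert i K = insert j K := h.injOn (hcard hi) (hcard hj) hij
  exact (Finset.mem_insert.1 (hins ▸ Finset.mem_insert_self i K)).resolve_right hi

theorem exists_iteratedFDeriv_eq_coeff (h : IsVertexMap n c θ) (hS : S.card = N + k) (hKS : K ⊆ S)
    (hK : K.card + 1 = N) (hx : ∀ j ∈ K, inner ℝ (n j) x - c j = 0)
    (hv : ∀ j ∈ K, inner ℝ (n j) v = 0) (hv' : ∀ i ∉ K, inner ℝ (n i) v ≠ 0) (hU : Convex ℝ U)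
    (hθU : ∀ H ⊆ S, H.card = N → θ H ∈ U) (hg : ∀ y ∈ U, ContDiffAt ℝ k g y) (P : PolyLE N k)
    (hP : ∀ H ⊆ S, H.card = N → evalAt P (θ H) = g (θ H)) :
    ∃ y ∈ U, (iteratedFDeriv ℝ k g y fun _ => v) =
      k.factorial * (restrictLine x v P.1).coeff k := by
  classical
  let t : ι → ℝ := fun i => -(inner ℝ (n i) x - c i) / inner ℝ (n i) v
  have ht {i : ι} (hi : i ∉ K) : x + t i • v = θ (insert i K) :=
    h.add_smul_eq_vertex hK hx hv hi (hv' i hi)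
  have hinj : Set.InjOn t ↑(S \ K) := fun i hi j hj hij => by
    have hi' := (Finset.mem_sdiff.1 hi).2
    have hj' := (Finset.mem_sdiff.1 hj).2
    exact h.insert_injOn hK hi' hj' ((ht hi').symm.trans (hij ▸ ht hj'))
  have hvertex : ∀ i ∈ S \ K, insert i K ⊆ S ∧ (insert i K).card = N := fun i hi => by
    rw [Finset.mem_sdiff] at hi
    exact ⟨Finset.insert_subset hi.1 hKS, by rw [Finset.card_insert_of_notMem hi.2, hK]⟩
  refine exists_iteratedFDeriv_eq_coeff_restrictLine hU hg P (Z := (S \ K).image t) ?_ ?_ ?_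
  · rw [Finset.card_image_of_injOn hinj, card_sdiff_eq_succ hS hKS hK]
  · rw [Finset.forall_mem_image]
    intro i hi
    rw [ht (Finset.mem_sdiff.1 hi).2]
    exact hθU _ (hvertex i hi).1 (hvertex i hi).2
  · rw [Finset.forall_mem_image]
    intro i hi
    rw [ht (Finset.mem_sdiff.1 hi).2]
    exact hP _ (hvertex i hi).1 (hvertex i hi).2

-- The corrected polynomial has `k + 2` nodes on the line directed by `v`, and its leading
-- coefficient there is the Newton coefficient times a product of inner products.
theorem abs_newtonCoeff_le [DecidableEq ι] (h : IsVertexMap n c θ) (hn : ∀ i, ‖n i‖ ≤ 1) {δ : ℝ}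
    (hδ : 0 < δ) (hvol : ∀ i : Fin N → ι, Function.Injective i →
      δ ≤ (volume : Measure (E N)).real (parallelepiped fun k => n (i k)))
    (hS : S.card = N + k) {a : ι} (ha : a ∉ S) (hKS : K ⊆ S) (hK : K.card + 1 = N)
    (hU : Convex ℝ U) (hθU : ∀ H ⊆ insert a S, H.card = N → θ H ∈ U)
    (hg : ∀ y ∈ U, ContDiffAt ℝ (k + 1 : ℕ) g y) {B : ℝ}
    (hB : ∀ y ∈ U, ∀ v, ‖v‖ ≤ 1 → ‖iteratedFDeriv ℝ (k + 1) g y fun _ => v‖ ≤ B) {Q : PolyLE N k}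
    (hQ : ∀ H ⊆ S, H.card = N → evalAt Q (θ H) = g (θ H)) :
    |newtonCoeff n c θ g S a Q K| ≤ B / δ ^ (k + 1) := by
  obtain ⟨v, hv1, hv0, hvδ⟩ := exists_transversal_direction hn hvol hK
  have hcard : (insert a K).card = N := by
    rw [Finset.card_insert_of_notMem fun haK => ha (hKS haK), hK]
  obtain ⟨y, hyU, hy⟩ := h.exists_iteratedFDeriv_eq_coeff (k := k + 1) (x := θ (insert a K))
    (by rw [Finset.card_insert_of_notMem ha, hS, add_assoc])
    (hKS.trans (Finset.subset_insert a S)) hK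
    (fun j hj => (h.inner_sub_eq_zero_iff hcard).2 (Finset.mem_insert_of_mem hj)) hv0
    (fun i hi => abs_pos.1 (hδ.trans_le (hvδ i hi))) hU hθU hg (newtonStep n c θ g hS a Q)
    fun H hHS hH => h.evalAt_newtonStep_eq hS ha hQ hHS hH
  rw [coeff_restrictLine_newtonStep hS Q _ hKS hK hv0] at hy
  have hprod : δ ^ (k + 1) ≤ |∏ i ∈ S \ K, inner ℝ (n i) v| := by
    rw [Finset.abs_prod, ← card_sdiff_eq_succ hS hKS hK, ← Finset.prod_const]
    exact Finset.prod_le_prod (fun _ _ => hδ.le) fun i hi => hvδ i (Finset.mem_sdiff.1 hi).2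
  have hfac : (1 : ℝ) ≤ (k + 1).factorial := mod_cast (k + 1).factorial_pos
  rw [le_div_iff₀ (pow_pos hδ _)]
  calc |newtonCoeff n c θ g S a Q K| * δ ^ (k + 1)
      ≤ |newtonCoeff n c θ g S a Q K| * |∏ i ∈ S \ K, inner ℝ (n i) v| := by gcongr
    _ ≤ (k + 1).factorial * (|newtonCoeff n c θ g S a Q K| * |∏ i ∈ S \ K, inner ℝ (n i) v|) :=
        le_mul_of_one_le_left (by positivity) hfac
    _ = ‖iteratedFDeriv ℝ (k + 1) g y fun _ => v‖ := by
        rw [hy, Real.norm_eq_abs, abs_mul, abs_mul, Nat.abs_cast]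
    _ ≤ B := hB y hyU v hv1

end IsVertexMap

end NewtonBound

section Convergence

variable {α : Type*} {l : Filter α} {N k : ℕ} {ι : Type*} {n : α → ι → E N} {c : α → ι → ℝ}
  {θ : α → Finset ι → E N} {g : E N → ℝ}

theorem isBigO_inner_sub (h : ∀ s, IsVertexMap (n s) (c s) (θ s)) (hn : ∀ s i, ‖n s i‖ ≤ 1)
    {H : Finset ι} (hH : H.card = N) (hθ : Tendsto (fun s => θ s H) l (𝓝 0)) {i : ι} (hi : i ∈ H)
    (x : E N) : (fun s => inner ℝ (n s i) x - c s i) =O[l] fun _ => (1 : ℝ) := by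
  have hle (s : α) : ‖inner ℝ (n s i) x - c s i‖ ≤ ‖x - θ s H‖ :=
    calc ‖inner ℝ (n s i) x - c s i‖ = ‖inner ℝ (n s i) (x - θ s H)‖ := by
          rw [inner_sub_right, ← sub_eq_zero.1 ((h s).inner_sub_eq_zero_iff hH |>.2 hi)]
      _ ≤ ‖n s i‖ * ‖x - θ s H‖ := norm_inner_le_norm _ _
      _ ≤ ‖x - θ s H‖ := mul_le_of_le_one_left (norm_nonneg _) (hn s i)
  exact (Asymptotics.isBigO_of_le l hle).trans ((tendsto_const_nhds.sub hθ).isBigO_one ℝ)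

variable {S K : Finset ι} {δ : ℝ}

theorem tendsto_newtonCoeff [DecidableEq ι] (h : ∀ s, IsVertexMap (n s) (c s) (θ s))
    (hn : ∀ s i, ‖n s i‖ ≤ 1) (hδ : 0 < δ) (hvol : ∀ s, ∀ i : Fin N → ι, Function.Injective i →
      δ ≤ (volume : Measure (E N)).real (parallelepiped fun j => n s (i j)))
    (hθ : ∀ H : Finset ι, H.card = N → Tendsto (fun s => θ s H) l (𝓝 0))
    (hg : ContDiffAt ℝ (k + 1 : ℕ) g 0)
    (hg0 : ∀ v, (iteratedFDeriv ℝ (k + 1) g 0 fun _ => v) = 0)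
    (hS : S.card = N + k) {a : ι} (ha : a ∉ S) (hKS : K ⊆ S) (hK : K.card + 1 = N)
    {Q : α → PolyLE N k} (hQ : ∀ s, ∀ H ⊆ S, H.card = N → evalAt (Q s) (θ s H) = g (θ s H)) :
    Tendsto (fun s => newtonCoeff (n s) (c s) (θ s) g S a (Q s) K) l (𝓝 0) := by
  rw [Metric.nhds_basis_closedBall.tendsto_right_iff]
  intro ε hε
  have hεδ : 0 < ε * δ ^ (k + 1) := by positivity
  obtain ⟨r, hr, hball⟩ := Metric.eventually_nhds_iff_ball.1
    ((hg.eventually (by simp)).and (eventually_norm_iteratedFDeriv_le hg hg0 hεδ))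
  have hvertex : ∀ᶠ s in l, ∀ H ∈ (insert a S).powerset, H.card = N → θ s H ∈ Metric.ball 0 r := by
    rw [Filter.eventually_all_finset]
    exact fun H _ => eventually_imp_distrib_left.2 fun hH =>
      (hθ H hH).eventually (Metric.ball_mem_nhds 0 hr)
  filter_upwards [hvertex] with s hs
  rw [mem_closedBall_zero_iff, Real.norm_eq_abs, ← mul_div_cancel_right₀ ε (pow_pos hδ (k + 1)).ne']
  exact (h s).abs_newtonCoeff_le (hn s) hδ (hvol s) hS ha hKS hK (convex_ball 0 r)
    (fun H hHS => hs H (Finset.mem_powerset.2 hHS)) (fun y hy => (hball y hy).1)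
    (fun y hy => (hball y hy).2) (hQ s)

theorem tendsto_evalAt_newtonStep [DecidableEq ι] (h : ∀ s, IsVertexMap (n s) (c s) (θ s))
    (hn : ∀ s i, ‖n s i‖ ≤ 1) (hθ : ∀ H : Finset ι, H.card = N → Tendsto (fun s => θ s H) l (𝓝 0))
    (hS : S.card = N + k) {a : ι} {Q : α → PolyLE N k} {x : E N}
    (hQ : Tendsto (fun s => evalAt (Q s) x) l (𝓝 0))
    (hcoeff : ∀ K ⊆ S, K.card + 1 = N →
      Tendsto (fun s => newtonCoeff (n s) (c s) (θ s) g S a (Q s) K) l (𝓝 0)) :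
    Tendsto (fun s => evalAt (newtonStep (n s) (c s) (θ s) g hS a (Q s)) x) l (𝓝 0) := by
  suffices hterm : ∀ K ∈ {K ∈ S.powerset | K.card + 1 = N}, Tendsto (fun s =>
      newtonCoeff (n s) (c s) (θ s) g S a (Q s) K * ∏ i ∈ S \ K, (inner ℝ (n s i) x - c s i))
      l (𝓝 0) by
    simpa only [evalAt_newtonStep, Finset.sum_const_zero, add_zero] using
      hQ.add (tendsto_finsetSum _ hterm)
  intro K hK
  rw [Finset.mem_filter, Finset.mem_powerset] at hK
  have hfactor : ∀ i ∈ S \ K,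
      (fun s => inner ℝ (n s i) x - c s i) =O[l] fun _ => (1 : ℝ) := fun i hi => by
    have hcard : (insert i K).card = N := by
      rw [Finset.card_insert_of_notMem (Finset.mem_sdiff.1 hi).2, hK.2]
    exact isBigO_inner_sub h hn hcard (hθ _ hcard) (Finset.mem_insert_self i K) x
  have hprod : (fun s => ∏ i ∈ S \ K, (inner ℝ (n s i) x - c s i)) =O[l] fun _ => (1 : ℝ) := by
    simpa only [Finset.prod_const_one] using Asymptotics.IsBigO.finsetProd hfactor
  have hterm := ((Asymptotics.isLittleO_one_iff ℝ).2 (hcoeff K hK.1 hK.2)).mul_isBigO hprod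
  simpa only [mul_one, Asymptotics.isLittleO_one_iff] using hterm

theorem exists_interpolants_tendsto_zero (h : ∀ s, IsVertexMap (n s) (c s) (θ s))
    (hn : ∀ s i, ‖n s i‖ ≤ 1) (hδ : 0 < δ) (hvol : ∀ s, ∀ i : Fin N → ι, Function.Injective i →
      δ ≤ (volume : Measure (E N)).real (parallelepiped fun j => n s (i j)))
    (hθ : ∀ H : Finset ι, H.card = N → Tendsto (fun s => θ s H) l (𝓝 0)) (hg : ContDiffAt ℝ k g 0)
    (hg0 : ∀ j ≤ k, ∀ v, (iteratedFDeriv ℝ j g 0 fun _ => v) = 0) (hS : S.card = N + k) :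
    ∃ P : α → PolyLE N k,
      (∀ s, ∀ H ⊆ S, H.card = N → evalAt (P s) (θ s H) = g (θ s H)) ∧
        ∀ x, Tendsto (fun s => evalAt (P s) x) l (𝓝 0) := by
  classical
  induction k generalizing S with
  | zero =>
    have hconst (r : ℝ) : MvPolynomial.C r ∈ PolyLE N 0 := by
      rw [MvPolynomial.mem_restrictTotalDegree, MvPolynomial.totalDegree_C]
    have heval (r : ℝ) (x : E N) : evalAt ⟨_, hconst r⟩ x = r := MvPolynomial.eval_C r
    have hg00 : g 0 = 0 := by simpa using hg0 0 le_rfl 0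
    refine ⟨fun s => ⟨_, hconst (g (θ s S))⟩, fun s H hHS hH => ?_, fun x => ?_⟩
    · rw [heval, Finset.eq_of_subset_of_card_le hHS (hS.trans hH.symm).le]
    · simpa only [heval, hg00, Function.comp_def] using
        hg.continuousAt.tendsto.comp (hθ S hS)
  | succ k ih =>
    obtain ⟨a, T, ha, rfl, hT⟩ := Finset.card_eq_succ.1 hS
    obtain ⟨Q, hQ, hQ0⟩ := ih (hg.of_le (mod_cast k.le_succ))
      (fun j hj => hg0 j (hj.trans k.le_succ)) hT
    refine ⟨fun s => newtonStep (n s) (c s) (θ s) g hT a (Q s),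
      fun s H => (h s).evalAt_newtonStep_eq hT ha (hQ s), fun x => ?_⟩
    exact tendsto_evalAt_newtonStep h hn hθ hT (hQ0 x) fun K hKS hK =>
      tendsto_newtonCoeff h hn hδ hvol hθ hg (hg0 (k + 1) le_rfl) hT ha hKS hK hQ

end Convergence

section Taylor

variable {N : ℕ}

/-- The power series at the origin of the Taylor polynomial of `f`. -/
def taylorSeries (m : ℕ) (f : E N → ℝ) : FormalMultilinearSeries ℝ (E N) ℝ := fun k =>
  if k ≤ m then (k.factorial : ℝ)⁻¹ • iteratedFDeriv ℝ k f 0 else 0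

theorem hasFPowerSeriesOnBall_taylor (m : ℕ) (f : E N → ℝ) :
    HasFPowerSeriesOnBall (evalAt (taylor m f)) (taylorSeries m f) 0 ⊤ := by
  refine (HasFiniteFPowerSeriesOnBall.mk' (n := m + 1) (fun k hk => if_neg (by lia)) (by simp)
    fun y _ => ?_).toHasFPowerSeriesOnBall
  rw [zero_add, taylor_evalAt]
  refine Finset.sum_congr rfl fun k hk => ?_
  simp only [if_pos (Finset.mem_range_succ_iff.1 hk), _root_.smul_apply, smul_eq_mul]

theorem contDiffAt_taylor (m k : ℕ) (f : E N → ℝ) : ContDiffAt ℝ k (evalAt (taylor m f)) 0 :=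
  (hasFPowerSeriesOnBall_taylor m f).analyticAt.contDiffAt

theorem iteratedFDeriv_taylor {m k : ℕ} (hk : k ≤ m) (f : E N → ℝ) (v : E N) :
    (iteratedFDeriv ℝ k (evalAt (taylor m f)) 0 fun _ => v) =
      iteratedFDeriv ℝ k f 0 fun _ => v := by
  rw [← (hasFPowerSeriesOnBall_taylor m f).factorial_smul v k]
  simp only [taylorSeries, if_pos hk, _root_.smul_apply, smul_eq_mul, nsmul_eq_mul]
  exact mul_inv_cancel_left₀ (mod_cast k.factorial_ne_zero) _

theorem iteratedFDeriv_sub_taylor {m k : ℕ} (hk : k ≤ m) {f : E N → ℝ} (hf : ContDiffAt ℝ k f 0)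
    (v : E N) : (iteratedFDeriv ℝ k (f - evalAt (taylor m f)) 0 fun _ => v) = 0 := by
  rw [iteratedFDeriv_sub_apply hf (contDiffAt_taylor m k f), _root_.sub_apply,
    iteratedFDeriv_taylor hk, sub_self]

end Taylor

theorem tendsto_zero_of_tendsto_sSup_norm {α V : Type*} [SeminormedAddCommGroup V] {l : Filter α}
    {A : α → Set V} (hA : ∀ s, (A s).Finite)
    (hsup : Tendsto (fun s => sSup ((fun y => ‖y‖) '' A s)) l (𝓝 0)) {x : α → V}
    (hx : ∀ s, x s ∈ A s) : Tendsto x l (𝓝 0) :=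
  squeeze_zero_norm (fun s => le_csSup ((hA s).image _).bddAbove (Set.mem_image_of_mem _ (hx s)))
    hsup

end ChungYao

end

open ChungYao in
theorem theorem3p1_general {α : Type*} {l : Filter α} {N d : ℕ} (hN : 0 < N) (hd : N ≤ d)
    {n : α → Fin d → E N} {c : α → Fin d → ℝ} (hn : ∀ s i, ‖n s i‖ ≤ 1)
    (hH : ∀ s, InGeneralPosition fun i => hyperplane (n s i) (c s i))
    (hC1 : Tendsto (fun s => sSup ((fun θ => ‖θ‖) '' lattice fun i => hyperplane (n s i) (c s i)))
      l (𝓝 0))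
    (hC2 : ∃ δ : ℝ, 0 < δ ∧ ∀ (s : α) (i : Fin N → Fin d), StrictMono i →
      δ ≤ (volume : Measure (E N)).real (parallelepiped fun k => n s (i k))) :
    ∃ hL : ∀ s, IsInterpolationLattice (d - N) (lattice fun i => hyperplane (n s i) (c s i)),
      ∀ f : E N → ℝ, ContDiffAt ℝ (d - N : ℕ) f 0 → ∀ p : Seminorm ℝ (PolyLE N (d - N)),
        Tendsto (fun s => p (lagrange (hL s) f - taylor (d - N) f)) l (𝓝 0) := by
  obtain ⟨δ, hδ, hvol⟩ := hC2
  choose! θ hθ using fun s => (hH s).singleton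
  have hvertex (s : α) : IsVertexMap (n s) (c s) (θ s) := (hH s).isVertexMap hN (hθ s)
  have hd' : Fintype.card (Fin d) = N + (d - N) := by rw [Fintype.card_fin, Nat.add_sub_cancel' hd]
  simp only [fun s => lattice_eq_image (hθ s)] at hC1 ⊢
  have hL (s : α) := (hvertex s).isInterpolationLattice hd'
  have hθ0 (H : Finset (Fin d)) (hHN : H.card = N) : Tendsto (fun s => θ s H) l (𝓝 0) :=
    tendsto_zero_of_tendsto_sSup_norm (fun s => (Set.toFinite _).image (θ s)) hC1
      fun s => Set.mem_image_of_mem _ hHN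
  refine ⟨hL, fun f hf p => ?_⟩
  obtain ⟨P, hP, hP0⟩ := exists_interpolants_tendsto_zero hvertex hn hδ
    (fun s => le_volume_of_injective (hvol s)) hθ0 (hf.sub (contDiffAt_taylor (d - N) (d - N) f))
    (fun k hk => iteratedFDeriv_sub_taylor hk (hf.of_le (mod_cast hk))) hd'
  have hlagrange (s : α) : lagrange (hL s) f = P s + taylor (d - N) f :=
    lagrange_eq (hL s) <| Set.forall_mem_image.2 fun H hHN => by
      rw [evalAt_add, hP s H (Finset.subset_univ H) hHN, sub_add_cancel]
  simpa only [hlagrange, add_sub_cancel_right] using tendsto_seminorm_of_evalAt hP0 p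

/-- The limit of polynomials is taken in the finite-dimensional space of polynomials of degree at
most `d - N`, with respect to every seminorm and in particular every norm on it. The supremum in
`hC1` is the maximum over a finite nonempty set. -/
theorem theorem3p1 (N d : ℕ) (hN : 2 ≤ N) (hd : N ≤ d)
    (n : ℕ → Fin d → ChungYao.E N) (c : ℕ → Fin d → ℝ)
    (hn : ∀ s i, ‖n s i‖ = 1)
    (hH : ∀ s, ChungYao.InGeneralPosition (fun i => ChungYao.hyperplane (n s i) (c s i)))
    (Θ : ℕ → Set (ChungYao.E N))
    (hΘ : ∀ s, Θ s = ChungYao.lattice (fun i => ChungYao.hyperplane (n s i) (c s i)))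
    (hC1 : Tendsto (fun s => sSup ((fun θ : ChungYao.E N => ‖θ‖) '' Θ s)) atTop (𝓝 0))
    (hC2 : ∃ δ : ℝ, 0 < δ ∧ ∀ (s : ℕ) (i : Fin N → Fin d), StrictMono i →
      δ ≤ (volume : Measure (ChungYao.E N)).real (parallelepiped (fun k => n s (i k)))) :
    ∃ hL : ∀ s, ChungYao.IsInterpolationLattice (d - N) (Θ s),
      ∀ (f : ChungYao.E N → ℝ) (Ω : Set (ChungYao.E N)), Ω ∈ 𝓝 (0 : ChungYao.E N) →
        ContDiffOn ℝ ((d - N + 1 : ℕ) : WithTop ℕ∞) f Ω →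
        ∀ p : Seminorm ℝ (ChungYao.PolyLE N (d - N)),
          Tendsto (fun s => p (ChungYao.lagrange (hL s) f - ChungYao.taylor (d - N) f))
            atTop (𝓝 0) := by
  obtain rfl := funext hΘ
  obtain ⟨hL, hlim⟩ := theorem3p1_general (by lia) hd (fun s i => (hn s i).le) hH hC1 hC2
  exact ⟨hL, fun f Ω hΩ hf =>
    hlim f ((hf.contDiffAt hΩ).of_le (mod_cast (d - N).le_succ))⟩
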